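/- Let $(B,g)$ be a connected smooth Riemannian surface, let $(F,\ddot g)$ be a non-empty smooth Riemannian surface that is Ricci-flat, and let $f\colon B\to(0,\infty)$ be a smooth positive function. Assume that the scalar curvature of $(B,g)$ is a constant multiple of $f$, that is, $R_B=c\,f$ on $B$ for some constant $c\in\mathbb R$. If the warped product $B\times_f F$, that is, the $4$-manifold $B\times F$ with the metric $\bar g=\pi_B^*g+(f\circ\pi_B)^2\,\pi_F^*\ddot g$ (where $\pi_B,\pi_F$ are the projections), is Ricci-flat, then $f$ is constant and $(B,g)$ is flat, i.e. its Riemann curvature tensor vanishes. -/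

import Mathlib

open scoped Manifold ContDiff Bundle

noncomputable section

namespace WarpedSurface

section Local

/-! Curvature of a field `G` of symmetric bilinear forms on a finite-dimensional real vector space
`E` (the coordinate space of a chart), written without choosing a basis of `E`. -/

variable {E : Type*} [NormedAddCommGroup E] [NormedSpace ℝ E]

/-- The pullback `(v, w) ↦ β (A v) (A w)` of a bilinear form `β` by a linear map `A`. -/
def pullbackForm {E' : Type*} [NormedAddCommGroup E'] [NormedSpace ℝ E']
    (A : E →L[ℝ] E') (β : E' →L[ℝ] E' →L[ℝ] ℝ) : E →L[ℝ] E →L[ℝ] ℝ :=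
  β.bilinearComp A A

/-- Christoffel symbols of the first kind: the linear form
`u ↦ ½ (∂ᵥ G(w, u) + ∂_w G(v, u) - ∂ᵤ G(v, w))`. -/
def christoffelFirst (G : E → E →L[ℝ] E →L[ℝ] ℝ) (y v w : E) : E →L[ℝ] ℝ :=
  (2⁻¹ : ℝ) • (fderiv ℝ (fun z => G z w) y v + fderiv ℝ (fun z => G z v) y w
    - fderiv ℝ (fun z => G z v w) y)

/-- Christoffel symbols of the second kind: `Γ(v, w)` is the vector with
`G(Γ(v, w), u) = ½ (∂ᵥ G(w, u) + ∂_w G(v, u) - ∂ᵤ G(v, w))` for all `u`; here `G y`, seen as a map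
from `E` to its dual, is inverted. -/
def christoffel (G : E → E →L[ℝ] E →L[ℝ] ℝ) (y v w : E) : E :=
  (G y).inverse (christoffelFirst G y v w)

/-- The Riemann curvature
`R(u, v) w = ∂ᵤ Γ(v, w) - ∂ᵥ Γ(u, w) + Γ(u, Γ(v, w)) - Γ(v, Γ(u, w))`. -/
def riemann (G : E → E →L[ℝ] E →L[ℝ] ℝ) (y u v w : E) : E :=
  fderiv ℝ (fun z => christoffel G z v w) y u - fderiv ℝ (fun z => christoffel G z u w) y v
    + christoffel G y u (christoffel G y v w) - christoffel G y v (christoffel G y u w)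

/-- The Ricci curvature `Ric(v, w) = tr (u ↦ R(u, v) w)`; the trace is computed in a basis. -/
def ricci [FiniteDimensional ℝ E] (G : E → E →L[ℝ] E →L[ℝ] ℝ) (y v w : E) : ℝ :=
  ∑ i, (Module.finBasis ℝ E).coord i (riemann G y (Module.finBasis ℝ E i) v w)

/-- The scalar curvature `∑ᵢⱼ Gⁱʲ Ric(bᵢ, bⱼ)` in a basis `b`, where
`Gⁱʲ = bⁱ (G⁻¹ bʲ)` are the entries of the inverse matrix of `G`. -/
def scalar [FiniteDimensional ℝ E] (G : E → E →L[ℝ] E →L[ℝ] ℝ) (y : E) : ℝ :=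
  ∑ i, ∑ j, (Module.finBasis ℝ E).coord i
      ((G y).inverse ((Module.finBasis ℝ E).coord j).toContinuousLinearMap) *
    ricci G y (Module.finBasis ℝ E i) (Module.finBasis ℝ E j)

end Local

section Global

variable {E : Type*} [NormedAddCommGroup E] [NormedSpace ℝ E]
  {H : Type*} [TopologicalSpace H] (I : ModelWithCorners ℝ E H)
  {M : Type*} [TopologicalSpace M] [ChartedSpace H M]

/-- A field of continuous bilinear forms on the tangent spaces of `M`. -/
abbrev FormField (M : Type*) [TopologicalSpace M] [ChartedSpace H M] :=
  ∀ x : M, TangentSpace I x →L[ℝ] TangentSpace I x →L[ℝ] ℝ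

variable {I}

/-- The coordinate expression of `g` in the chart `e`: the pullback of `g` by the inverse of the
chart. It is meaningful on the target of the chart, which is open in `E` when `I` has no boundary
(the only case in which this is used). -/
def inChart (g : FormField I M) (e : OpenPartialHomeomorph M H) (y : E) : E →L[ℝ] E →L[ℝ] ℝ :=
  pullbackForm (E := E) (E' := E) (mfderiv 𝓘(ℝ, E) I (e.extend I).symm y) (g ((e.extend I).symm y))

/-- `Ric = 0`, expressed in every chart of the atlas. -/
def IsRicciFlat [FiniteDimensional ℝ E] (g : FormField I M) : Prop :=
  ∀ e ∈ atlas H M, ∀ y ∈ (e.extend I).target, ∀ v w, ricci (inChart g e) y v w = 0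

/-- The Riemann curvature tensor vanishes, expressed in every chart of the atlas. -/
def IsFlat (g : FormField I M) : Prop :=
  ∀ e ∈ atlas H M, ∀ y ∈ (e.extend I).target, ∀ u v w, riemann (inChart g e) y u v w = 0

/-- The scalar curvature of `g` is the function `ρ`, expressed in every chart of the atlas. -/
def HasScalarCurvature [FiniteDimensional ℝ E] (g : FormField I M) (ρ : M → ℝ) : Prop :=
  ∀ e ∈ atlas H M, ∀ y ∈ (e.extend I).target,
    scalar (inChart g e) y = ρ ((e.extend I).symm y)

/-- The warped product metric `π_B^* g + (f ∘ π_B)² π_F^* k` on `B × F`. -/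
def warped {E' : Type*} [NormedAddCommGroup E'] [NormedSpace ℝ E']
    {H' : Type*} [TopologicalSpace H'] {J : ModelWithCorners ℝ E' H'}
    {B : Type*} [TopologicalSpace B] [ChartedSpace H B]
    {F : Type*} [TopologicalSpace F] [ChartedSpace H' F]
    (g : FormField I B) (f : B → ℝ) (k : FormField J F) : FormField (I.prod J) (B × F) :=
  fun p =>
    (pullbackForm (E := E × E') (E' := E) (mfderiv (I.prod J) I Prod.fst p) (g p.1) +
      (f p.1) ^ 2 •
        pullbackForm (E := E × E') (E' := E') (mfderiv (I.prod J) J Prod.snd p) (k p.2) :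
      E × E' →L[ℝ] E × E' →L[ℝ] ℝ)

end Global

end WarpedSurface

end

/-! Write `m = 2` for the dimension of the fibre. The Ricci form of the warped product is `Ric_B -
(m/f) Hess f` on horizontal vectors. On vertical vectors it is `Ric_F - (f Δf + (m-1)|∇f|²) k`. As
both the product and the fibre are Ricci-flat, `Ric_B = (2/f) Hess f` and `f Δf + |∇f|² = 0`.
Tracing the first equation and using `R_B = c f` gives `Δf = c f²/2`, hence `|∇f|² = -c f³/2`.

On a surface the Ricci form is half the scalar curvature times the metric, so `Hess f = (c f²/4) g`.
Differentiating `|∇f|²` along `u` in two ways yields `(c/2) f² df(u) = -(3c/2) f² df(u)`, that is `c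
f² df = 0`. If `c ≠ 0` then `df = 0`; if `c = 0` then `|∇f|² = 0`, and again `df = 0`. Now `Hess f =
0`, so `Ric_B = 0`, and on a surface the Ricci form determines the whole curvature.

The computation is done in charts. `ricci_warpedForm_horizontal` and `ricci_warpedForm_vertical`
give the two Ricci formulas, `IsMetricOn.riemann_eq_ricci` and `IsMetricOn.apply_eq_trace_mul` the
facts on surfaces, and `inChart_warped` identifies the product metric in a product chart.
Connectedness of the base is used only to pass from locally constant to constant. -/

noncomputable section

namespace WarpedSurface

/-! ### Levi-Civita calculus of a metric on an open subset of a vector space. -/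

section Local

variable {E : Type*} [NormedAddCommGroup E] [NormedSpace ℝ E]

/-- `G` is the coordinate expression of a smooth Riemannian metric on the open set `U`. -/
structure IsMetricOn (G : E → E →L[ℝ] E →L[ℝ] ℝ) (U : Set E) : Prop where
  isOpen : IsOpen U
  contDiffOn : ContDiffOn ℝ ∞ G U
  symm : ∀ y ∈ U, ∀ v w, G y v w = G y w v
  pos : ∀ y ∈ U, ∀ v, v ≠ 0 → 0 < G y v v

/-- The gradient of `φ` with respect to `G`. -/
def grad (G : E → E →L[ℝ] E →L[ℝ] ℝ) (φ : E → ℝ) (y : E) : E :=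
  (G y).inverse (fderiv ℝ φ y)

/-- The Hessian of `φ` with respect to `G`. -/
def hess (G : E → E →L[ℝ] E →L[ℝ] ℝ) (φ : E → ℝ) (y v w : E) : ℝ :=
  fderiv ℝ (fderiv ℝ φ) y v w - fderiv ℝ φ y (christoffel G y v w)

/-- The covariant derivative of the gradient of `φ` in the direction `u`. -/
def covGrad (G : E → E →L[ℝ] E →L[ℝ] ℝ) (φ : E → ℝ) (y u : E) : E :=
  fderiv ℝ (grad G φ) y u + christoffel G y u (grad G φ y)

lemma christoffel_congr {G G' : E → E →L[ℝ] E →L[ℝ] ℝ} {U : Set E} (hU : IsOpen U)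
    (h : ∀ y ∈ U, G y = G' y) {y : E} (hy : y ∈ U) (v w : E) :
    christoffel G y v w = christoffel G' y v w := by
  have h' : G =ᶠ[nhds y] G' := Filter.eventuallyEq_of_mem (hU.mem_nhds hy) h
  have h1 : ∀ a, (fun z => G z a) =ᶠ[nhds y] fun z => G' z a :=
    fun a => h'.mono fun z hz => by simp only [hz]
  have h2 : (fun z => G z v w) =ᶠ[nhds y] fun z => G' z v w :=
    h'.mono fun z hz => by simp only [hz]
  rw [christoffel, christoffel, christoffelFirst, christoffelFirst, h y hy, (h1 w).fderiv_eq,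
    (h1 v).fderiv_eq, h2.fderiv_eq]

lemma riemann_congr {G G' : E → E →L[ℝ] E →L[ℝ] ℝ} {U : Set E} (hU : IsOpen U)
    (h : ∀ y ∈ U, G y = G' y) {y : E} (hy : y ∈ U) (u v w : E) :
    riemann G y u v w = riemann G' y u v w := by
  have h1 : ∀ a b, (fun z => christoffel G z a b) =ᶠ[nhds y] fun z => christoffel G' z a b :=
    fun a b => Filter.eventuallyEq_of_mem (hU.mem_nhds hy)
      fun z hz => christoffel_congr hU h hz a b
  simp only [riemann, christoffel_congr hU h hy, (h1 _ _).fderiv_eq]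

/-- Curvature depends only on the germ of the metric. This allows a metric in a chart to be replaced
by a formula valid only on the chart's target. -/
lemma ricci_congr [FiniteDimensional ℝ E] {G G' : E → E →L[ℝ] E →L[ℝ] ℝ} {U : Set E}
    (hU : IsOpen U) (h : ∀ y ∈ U, G y = G' y) {y : E} (hy : y ∈ U) (v w : E) :
    ricci G y v w = ricci G' y v w := by
  simp only [ricci, riemann_congr hU h hy]

namespace IsMetricOn

variable {G : E → E →L[ℝ] E →L[ℝ] ℝ} {U : Set E} {y : E}

lemma contDiffAt (h : IsMetricOn G U) (hy : y ∈ U) : ContDiffAt ℝ ∞ G y :=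
  h.contDiffOn.contDiffAt (h.isOpen.mem_nhds hy)

lemma differentiableAt (h : IsMetricOn G U) (hy : y ∈ U) : DifferentiableAt ℝ G y :=
  (h.contDiffAt hy).differentiableAt (by simp)

lemma ext (h : IsMetricOn G U) (hy : y ∈ U) {v w : E} (hvw : ∀ u, G y v u = G y w u) :
    v = w := by
  by_contra hne
  have := h.pos y hy (v - w) (sub_ne_zero.2 hne)
  simp [hvw] at this

lemma fderiv_symm (h : IsMetricOn G U) (hy : y ∈ U) (u v w : E) :
    fderiv ℝ G y u v w = fderiv ℝ G y u w v := by
  have hd := (h.differentiableAt hy).hasFDerivAt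
  have h1 := (hd.clm_apply (hasFDerivAt_const v y)).clm_apply (hasFDerivAt_const w y)
  have h2 := (hd.clm_apply (hasFDerivAt_const w y)).clm_apply (hasFDerivAt_const v y)
  have h3 : (fun z => G z v w) =ᶠ[nhds y] fun z => G z w v :=
    Filter.eventuallyEq_of_mem (h.isOpen.mem_nhds hy) fun z hz => h.symm z hz v w
  have := congrArg (fun L => L u) (h1.unique (h2.congr_of_eventuallyEq h3))
  simpa using this

lemma christoffelFirst_apply (h : IsMetricOn G U) (hy : y ∈ U) (v w u : E) :
    christoffelFirst G y v w u =
      2⁻¹ * (fderiv ℝ G y v w u + fderiv ℝ G y w v u - fderiv ℝ G y u v w) := by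
  have hd := (h.differentiableAt hy).hasFDerivAt
  have h1 := fun a => (hd.clm_apply (hasFDerivAt_const a y))
  have h2 := (h1 v).clm_apply (hasFDerivAt_const w y)
  rw [christoffelFirst, (h1 v).fderiv, (h1 w).fderiv, h2.fderiv]
  simp

variable [FiniteDimensional ℝ E]

/-- A definite form is nondegenerate, and a space and its dual have equal dimension. Hence `inverse`
is a genuine inverse on `U`, not its default value. -/
lemma isInvertible (h : IsMetricOn G U) (hy : y ∈ U) : (G y).IsInvertible := by
  have hinj : Function.Injective (G y : E →ₗ[ℝ] E →L[ℝ] ℝ) := fun v w hvw =>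
    h.ext hy fun u => by
      have : G y v = G y w := hvw
      rw [this]
  have hrank : Module.finrank ℝ E = Module.finrank ℝ (E →L[ℝ] ℝ) := by
    rw [← (LinearMap.toContinuousLinearMap (𝕜 := ℝ) (E := E) (F' := ℝ)).finrank_eq]
    exact (Subspace.dual_finrank_eq (K := ℝ) (V := E)).symm
  refine ⟨(LinearEquiv.ofInjectiveOfFinrankEq _ hinj hrank).toContinuousLinearEquiv, ?_⟩
  ext v w
  rfl

lemma apply_inverse (h : IsMetricOn G U) (hy : y ∈ U) (l : E →L[ℝ] ℝ) :
    G y ((G y).inverse l) = l :=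
  (h.isInvertible hy).self_apply_inverse l

lemma apply_christoffel (h : IsMetricOn G U) (hy : y ∈ U) (v w u : E) :
    G y (christoffel G y v w) u =
      2⁻¹ * (fderiv ℝ G y v w u + fderiv ℝ G y w v u - fderiv ℝ G y u v w) := by
  rw [christoffel, h.apply_inverse hy, h.christoffelFirst_apply hy]

/-- The Koszul formula as a characterization: a candidate for the Christoffel symbol is verified by
pairing it with every `u`, without inverting the metric. -/
lemma christoffel_eq (h : IsMetricOn G U) (hy : y ∈ U) {v w x : E}
    (hx : ∀ u, G y x u =
      2⁻¹ * (fderiv ℝ G y v w u + fderiv ℝ G y w v u - fderiv ℝ G y u v w)) :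
    christoffel G y v w = x :=
  h.ext hy fun u => by rw [h.apply_christoffel hy, hx]

lemma christoffel_symm (h : IsMetricOn G U) (hy : y ∈ U) (v w : E) :
    christoffel G y v w = christoffel G y w v :=
  h.christoffel_eq hy fun u => by
    rw [h.apply_christoffel hy, h.fderiv_symm hy u w v]; ring

set_option synthInstance.maxHeartbeats 200000 in
lemma christoffel_add (h : IsMetricOn G U) (hy : y ∈ U) (v v' w : E) :
    christoffel G y (v + v') w = christoffel G y v w + christoffel G y v' w :=
  h.christoffel_eq hy fun u => by
    simp only [map_add, add_apply, h.apply_christoffel hy]; ring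

set_option synthInstance.maxHeartbeats 200000 in
lemma christoffel_smul (h : IsMetricOn G U) (hy : y ∈ U) (r : ℝ) (v w : E) :
    christoffel G y (r • v) w = r • christoffel G y v w :=
  h.christoffel_eq hy fun u => by
    simp only [map_smul, smul_apply, h.apply_christoffel hy, smul_eq_mul]; ring

lemma christoffel_add_right (h : IsMetricOn G U) (hy : y ∈ U) (v w w' : E) :
    christoffel G y v (w + w') = christoffel G y v w + christoffel G y v w' := by
  simp only [h.christoffel_symm hy v, h.christoffel_add hy]

lemma christoffel_smul_right (h : IsMetricOn G U) (hy : y ∈ U) (r : ℝ) (v w : E) :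
    christoffel G y v (r • w) = r • christoffel G y v w := by
  simp only [h.christoffel_symm hy v, h.christoffel_smul hy]

/-- The Christoffel symbols are compatible with the metric. -/
lemma fderiv_eq_christoffel (h : IsMetricOn G U) (hy : y ∈ U) (u v w : E) :
    fderiv ℝ G y u v w = G y (christoffel G y u v) w + G y v (christoffel G y u w) := by
  rw [h.symm y hy v, h.apply_christoffel hy, h.apply_christoffel hy, h.fderiv_symm hy u w v,
    h.fderiv_symm hy v u w, h.fderiv_symm hy w u v]
  ring

lemma contDiffAt_inverse (h : IsMetricOn G U) (hy : y ∈ U) :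
    ContDiffAt ℝ ∞ (fun z => (G z).inverse) y := by
  obtain ⟨e, he⟩ := h.isInvertible hy
  have := contDiffAt_map_inverse (𝕜 := ℝ) (n := ∞) e
  rw [he] at this
  exact this.comp y (h.contDiffAt hy)

lemma contDiffAt_christoffel (h : IsMetricOn G U) (hy : y ∈ U) (v w : E) :
    ContDiffAt ℝ ∞ (fun z => christoffel G z v w) y := by
  refine (h.contDiffAt_inverse hy).clm_apply ?_
  have h1 : ∀ a, ContDiffAt ℝ ∞ (fun z => G z a) y := fun a =>
    (h.contDiffAt hy).clm_apply contDiffAt_const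
  have h2 : ContDiffAt ℝ ∞ (fun z => G z v w) y := (h1 v).clm_apply contDiffAt_const
  exact (contDiffAt_const (c := (2⁻¹ : ℝ))).smul
    (((((h1 w).fderiv_right (m := ∞) le_rfl).clm_apply contDiffAt_const).add
      (((h1 v).fderiv_right (m := ∞) le_rfl).clm_apply contDiffAt_const)).sub
      (h2.fderiv_right (m := ∞) le_rfl))

lemma differentiableAt_christoffel (h : IsMetricOn G U) (hy : y ∈ U) (v w : E) :
    DifferentiableAt ℝ (fun z => christoffel G z v w) y :=
  (h.contDiffAt_christoffel hy v w).differentiableAt (by simp)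

lemma fderiv_christoffel_add (h : IsMetricOn G U) (hy : y ∈ U) (v v' w : E) :
    fderiv ℝ (fun z => christoffel G z (v + v') w) y =
      fderiv ℝ (fun z => christoffel G z v w) y + fderiv ℝ (fun z => christoffel G z v' w) y := by
  rw [← fderiv_add (h.differentiableAt_christoffel hy v w)
    (h.differentiableAt_christoffel hy v' w)]
  exact Filter.EventuallyEq.fderiv_eq (Filter.eventuallyEq_of_mem (h.isOpen.mem_nhds hy)
    fun z hz => h.christoffel_add hz v v' w)

lemma fderiv_christoffel_smul (h : IsMetricOn G U) (hy : y ∈ U) (r : ℝ) (v w : E) :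
    fderiv ℝ (fun z => christoffel G z (r • v) w) y =
      r • fderiv ℝ (fun z => christoffel G z v w) y := by
  rw [← fderiv_const_smul (h.differentiableAt_christoffel hy v w)]
  exact Filter.EventuallyEq.fderiv_eq (Filter.eventuallyEq_of_mem (h.isOpen.mem_nhds hy)
    fun z hz => h.christoffel_smul hz r v w)

end IsMetricOn

lemma riemann_antisymm (G : E → E →L[ℝ] E →L[ℝ] ℝ) (y u v w : E) :
    riemann G y u v w = -riemann G y v u w := by
  simp only [riemann]; abel

namespace IsMetricOn

variable {G : E → E →L[ℝ] E →L[ℝ] ℝ} {U : Set E} {y : E} [FiniteDimensional ℝ E]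

/-- The curvature `R(u, v) w` as a bilinear map of `v` and `u`. -/
def riemannMap (h : IsMetricOn G U) (hy : y ∈ U) (w : E) : E →ₗ[ℝ] E →ₗ[ℝ] E :=
  have hadd : ∀ u u' v, riemann G y (u + u') v w = riemann G y u v w + riemann G y u' v w := by
    intro u u' v
    simp only [riemann, h.fderiv_christoffel_add hy, h.christoffel_add hy,
      h.christoffel_add_right hy, map_add, add_apply]
    abel
  have hsmul : ∀ (r : ℝ) u v, riemann G y (r • u) v w = r • riemann G y u v w := by
    intro r u v
    simp only [riemann, h.fderiv_christoffel_smul hy, h.christoffel_smul hy,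
      h.christoffel_smul_right hy, map_smul, smul_apply]
    module
  LinearMap.mk₂ ℝ (fun v u => riemann G y u v w)
    (fun v v' u => by simp only [riemann_antisymm G y u, hadd]; abel)
    (fun r v u => by simp only [riemann_antisymm G y u, hsmul]; module)
    (fun v u u' => hadd u u' v) (fun r v u => hsmul r u v)

@[simp] lemma riemannMap_apply (h : IsMetricOn G U) (hy : y ∈ U) (u v w : E) :
    h.riemannMap hy w v u = riemann G y u v w := rfl

/-- A basis-free trace can be split along a product, which the fixed basis in `ricci` does not
allow. -/
lemma ricci_eq_trace (h : IsMetricOn G U) (hy : y ∈ U) (v w : E) :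
    ricci G y v w = LinearMap.trace ℝ E (h.riemannMap hy w v) := by
  rw [LinearMap.trace_eq_matrix_trace ℝ (Module.finBasis ℝ E), Matrix.trace]
  simp [ricci, LinearMap.toMatrix_apply]

/-- The curvature endomorphisms are skew-adjoint. -/
lemma apply_riemann_self (h : IsMetricOn G U) (hy : y ∈ U) (u v w : E) :
    G y (riemann G y u v w) w = 0 := by
  have hG := (h.differentiableAt hy).hasFDerivAt
  -- Metric compatibility applied to `G(w, w)`; it is needed near `y` because it is differentiated
  -- again.
  have hev : ∀ a, ∀ᶠ z in nhds y, fderiv ℝ (fun z => G z w w) z a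
      = 2 * G z (christoffel G z a w) w := fun a =>
    Filter.eventually_of_mem (h.isOpen.mem_nhds hy) fun z hz => by
      have hd := (h.differentiableAt hz).hasFDerivAt
      have h1 := (hd.clm_apply (hasFDerivAt_const w z)).clm_apply (hasFDerivAt_const w z)
      rw [h1.fderiv]
      simp only [ContinuousLinearMap.comp_zero, zero_add, ContinuousLinearMap.flip_apply]
      rw [h.fderiv_eq_christoffel hz, h.symm z hz w]
      ring
  have hC : ContDiffAt ℝ ∞ (fun z => G z w w) y :=
    ((h.contDiffAt hy).clm_apply contDiffAt_const).clm_apply contDiffAt_const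
  have hsymm := hC.isSymmSndFDerivAt (by simpa using ENat.LEInfty.out)
  have hdd : ∀ a b, fderiv ℝ (fderiv ℝ (fun z => G z w w)) y b a =
      2 * (G y (fderiv ℝ (fun z => christoffel G z a w) y b) w
        + G y (christoffel G y b (christoffel G y a w)) w
        + G y (christoffel G y a w) (christoffel G y b w)) := fun a b => by
    have hF := ((hC.fderiv_right (m := ∞) le_rfl).differentiableAt (by simp)).hasFDerivAt
    have h1 := hF.clm_apply (hasFDerivAt_const a y)
    have h2 := (((hG.clm_apply (h.differentiableAt_christoffel hy a w).hasFDerivAt).clm_apply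
      (hasFDerivAt_const w y)).const_mul 2)
    have := congrArg (fun L => L b) (h1.unique (h2.congr_of_eventuallyEq (hev a)))
    simp only [ContinuousLinearMap.comp_zero, zero_add, ContinuousLinearMap.flip_apply,
      add_apply, smul_apply, ContinuousLinearMap.comp_apply, smul_eq_mul,
      h.fderiv_eq_christoffel hy] at this
    rw [this]; ring
  -- Second derivatives of `G(w, w)` commute. Their antisymmetrization in `u`, `v` is `2 G(R(u, v)
  -- w, w)`, since the term `G(Γ(u, w), Γ(v, w))` is symmetric.
  have key := hsymm u v
  rw [hdd, hdd, h.symm y hy (christoffel G y u w) (christoffel G y v w)] at key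
  simp only [riemann, map_sub, map_add, add_apply, sub_apply]
  linarith

variable {φ : E → ℝ}

lemma apply_grad (h : IsMetricOn G U) (hy : y ∈ U) : G y (grad G φ y) = fderiv ℝ φ y :=
  h.apply_inverse hy _

lemma contDiffAt_grad (h : IsMetricOn G U) (hφ : ContDiffOn ℝ ∞ φ U) (hy : y ∈ U) :
    ContDiffAt ℝ ∞ (grad G φ) y :=
  (h.contDiffAt_inverse hy).clm_apply
    ((hφ.contDiffAt (h.isOpen.mem_nhds hy)).fderiv_right (m := ∞) le_rfl)

/-- Differentiate `G(grad φ) = dφ` and use metric compatibility. -/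
lemma apply_covGrad (h : IsMetricOn G U) (hφ : ContDiffOn ℝ ∞ φ U) (hy : y ∈ U) (u w : E) :
    G y (covGrad G φ y u) w = hess G φ y u w := by
  have hG := (h.differentiableAt hy).hasFDerivAt
  have hgr := ((h.contDiffAt_grad hφ hy).differentiableAt (by simp)).hasFDerivAt
  have hF := (((hφ.contDiffAt (h.isOpen.mem_nhds hy)).fderiv_right
    (m := ∞) le_rfl).differentiableAt (by simp)).hasFDerivAt
  have hev : (fun z => G z (grad G φ z)) =ᶠ[nhds y] fderiv ℝ φ :=
    Filter.eventuallyEq_of_mem (h.isOpen.mem_nhds hy) fun z hz => h.apply_grad hz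
  have := congrArg (fun L => L u w)
    ((hG.clm_apply hgr).unique (hF.congr_of_eventuallyEq hev))
  simp only [ContinuousLinearMap.flip_apply, add_apply, ContinuousLinearMap.comp_apply,
    h.fderiv_eq_christoffel hy, h.apply_grad hy] at this
  rw [covGrad, hess, ← this, map_add, add_apply]
  ring

lemma hess_symm (h : IsMetricOn G U) (hφ : ContDiffOn ℝ ∞ φ U) (hy : y ∈ U) (u w : E) :
    hess G φ y u w = hess G φ y w u := by
  have hsymm := (hφ.contDiffAt (h.isOpen.mem_nhds hy)).isSymmSndFDerivAt (by simpa using ENat.LEInfty.out)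
  rw [hess, hess, hsymm u w, h.christoffel_symm hy]

/-- The covariant derivative of the gradient as a linear map. -/
def covGradMap (h : IsMetricOn G U) (hy : y ∈ U) (φ : E → ℝ) : E →ₗ[ℝ] E where
  toFun := covGrad G φ y
  map_add' u v := by simp only [covGrad, map_add, h.christoffel_add hy]; abel
  map_smul' r u := by
    simp only [covGrad, map_smul, h.christoffel_smul hy, RingHom.id_apply]; module

@[simp] lemma covGradMap_apply (h : IsMetricOn G U) (hy : y ∈ U) (φ : E → ℝ) (u : E) :
    h.covGradMap hy φ u = covGrad G φ y u := rfl

/-- If the Ricci form is represented by a self-adjoint endomorphism `S`, then the scalar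
curvature is the trace of `S`. -/
lemma scalar_eq_trace (h : IsMetricOn G U) (hy : y ∈ U) (S : E →ₗ[ℝ] E)
    (hS : ∀ v w, ricci G y v w = G y (S v) w) (hS' : ∀ v w, G y (S v) w = G y (S w) v) :
    scalar G y = LinearMap.trace ℝ E S := by
  rw [LinearMap.trace_eq_matrix_trace ℝ (Module.finBasis ℝ E), Matrix.trace, scalar,
    Finset.sum_comm]
  refine Finset.sum_congr rfl fun j _ => ?_
  set b := Module.finBasis ℝ E
  -- `X` is the `j`-th dual basis covector with its index raised; its coordinates are the
  -- inverse-matrix entries in `scalar`.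
  set X := (G y).inverse (b.coord j).toContinuousLinearMap
  have hX : ∀ v, G y X v = b.coord j v := fun v => by
    rw [h.apply_inverse hy]; rfl
  calc ∑ i, b.coord i X * ricci G y (b i) (b j)
      = G y (S (∑ i, b.coord i X • b i)) (b j) := by
        simp only [hS, map_sum, map_smul, sum_apply,
          smul_apply, smul_eq_mul]
    _ = b.coord j (S (b j)) := by
        rw [show ∑ i, b.coord i X • b i = X from b.sum_repr X, hS', h.symm y hy, hX]
    _ = _ := by simp [LinearMap.toMatrix_apply]

end IsMetricOn

end Local

/-! ### Christoffel symbols, curvature and Ricci form of a warped product. -/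

section LocalWarped

variable {E : Type*} [NormedAddCommGroup E] [NormedSpace ℝ E]
  {E' : Type*} [NormedAddCommGroup E'] [NormedSpace ℝ E']

@[simp] lemma pullbackForm_apply (A : E →L[ℝ] E') (β : E' →L[ℝ] E' →L[ℝ] ℝ) (v w : E) :
    pullbackForm A β v w = β (A v) (A w) := rfl

/-- The coordinate expression of a warped product metric. -/
def warpedForm (G : E → E →L[ℝ] E →L[ℝ] ℝ) (φ : E → ℝ) (K : E' → E' →L[ℝ] E' →L[ℝ] ℝ)
    (z : E × E') : E × E' →L[ℝ] E × E' →L[ℝ] ℝ :=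
  pullbackForm (ContinuousLinearMap.fst ℝ E E') (G z.1) +
    (φ z.1) ^ 2 • pullbackForm (ContinuousLinearMap.snd ℝ E E') (K z.2)

@[simp] lemma warpedForm_apply (G : E → E →L[ℝ] E →L[ℝ] ℝ) (φ : E → ℝ)
    (K : E' → E' →L[ℝ] E' →L[ℝ] ℝ) (z a b : E × E') :
    warpedForm G φ K z a b = G z.1 a.1 b.1 + φ z.1 ^ 2 * K z.2 a.2 b.2 := rfl

variable {G : E → E →L[ℝ] E →L[ℝ] ℝ} {φ : E → ℝ} {K : E' → E' →L[ℝ] E' →L[ℝ] ℝ}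
  {U : Set E} {V : Set E'} {z : E × E'}

variable [FiniteDimensional ℝ E] [FiniteDimensional ℝ E']

lemma IsMetricOn.warpedForm (hG : IsMetricOn G U) (hφ : ContDiffOn ℝ ∞ φ U)
    (hpos : ∀ y ∈ U, 0 < φ y) (hK : IsMetricOn K V) :
    IsMetricOn (warpedForm G φ K) (U ×ˢ V) where
  isOpen := hG.isOpen.prod hK.isOpen
  contDiffOn := by
    refine contDiffOn_clm_apply.2 fun a => contDiffOn_clm_apply.2 fun b => ?_
    have h1 : Set.MapsTo Prod.fst (U ×ˢ V) U := fun z hz => hz.1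
    have h2 : Set.MapsTo Prod.snd (U ×ˢ V) V := fun z hz => hz.2
    have hG' : ContDiffOn ℝ ∞ (fun y => G y a.1 b.1) U :=
      (hG.contDiffOn.clm_apply contDiffOn_const).clm_apply contDiffOn_const
    have hK' : ContDiffOn ℝ ∞ (fun y => K y a.2 b.2) V :=
      (hK.contDiffOn.clm_apply contDiffOn_const).clm_apply contDiffOn_const
    exact (hG'.comp contDiff_fst.contDiffOn h1).add
      (((hφ.comp contDiff_fst.contDiffOn h1).pow 2).mul (hK'.comp contDiff_snd.contDiffOn h2))
  symm z hz v w := by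
    simp only [warpedForm_apply, hG.symm z.1 hz.1 v.1, hK.symm z.2 hz.2 v.2]
  pos z hz v hv := by
    have hφ0 := hpos z.1 hz.1
    rw [warpedForm_apply]
    by_cases h1 : v.1 = 0
    · have h2 : v.2 ≠ 0 := fun h2 => hv (Prod.ext h1 h2)
      have := hK.pos z.2 hz.2 _ h2
      rw [h1]
      simp only [map_zero, zero_add]
      positivity
    · have := hG.pos z.1 hz.1 _ h1
      have h3 : 0 ≤ K z.2 v.2 v.2 := by
        by_cases h2 : v.2 = 0
        · simp [h2]
        · exact (hK.pos z.2 hz.2 _ h2).le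
      positivity

lemma fderiv_warpedForm (hG : IsMetricOn G U) (hφ : ContDiffOn ℝ ∞ φ U)
    (hpos : ∀ y ∈ U, 0 < φ y) (hK : IsMetricOn K V) (hz : z ∈ U ×ˢ V) (d a b : E × E') :
    fderiv ℝ (warpedForm G φ K) z d a b = fderiv ℝ G z.1 d.1 a.1 b.1
      + 2 * φ z.1 * fderiv ℝ φ z.1 d.1 * K z.2 a.2 b.2
      + φ z.1 ^ 2 * fderiv ℝ K z.2 d.2 a.2 b.2 := by
  have hW := ((((hG.warpedForm hφ hpos hK).differentiableAt hz).hasFDerivAt.clm_apply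
    (hasFDerivAt_const a z)).clm_apply (hasFDerivAt_const b z))
  have hG' := (((hG.differentiableAt hz.1).hasFDerivAt.clm_apply
    (hasFDerivAt_const a.1 z.1)).clm_apply (hasFDerivAt_const b.1 z.1)).comp z hasFDerivAt_fst
  have hK' := (((hK.differentiableAt hz.2).hasFDerivAt.clm_apply
    (hasFDerivAt_const a.2 z.2)).clm_apply (hasFDerivAt_const b.2 z.2)).comp z hasFDerivAt_snd
  have hφ' := ((hφ.contDiffAt (hG.isOpen.mem_nhds hz.1)).differentiableAt
    (by simp)).hasFDerivAt.comp z hasFDerivAt_fst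
  have h := congrArg (fun L => L d) (hW.unique (hG'.add ((hφ'.pow 2).mul hK')))
  simp only [ContinuousLinearMap.comp_zero, zero_add, ContinuousLinearMap.flip_apply,
    add_apply, smul_apply, ContinuousLinearMap.comp_apply, smul_eq_mul,
    ContinuousLinearMap.coe_fst', ContinuousLinearMap.coe_snd', Function.comp_apply] at h
  rw [h]
  simp
  ring

lemma christoffel_warpedForm (hG : IsMetricOn G U) (hφ : ContDiffOn ℝ ∞ φ U)
    (hpos : ∀ y ∈ U, 0 < φ y) (hK : IsMetricOn K V) (hz : z ∈ U ×ˢ V) (v w : E × E') :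
    christoffel (warpedForm G φ K) z v w =
      (christoffel G z.1 v.1 w.1 - (φ z.1 * K z.2 v.2 w.2) • grad G φ z.1,
        christoffel K z.2 v.2 w.2 + (fderiv ℝ φ z.1 v.1 / φ z.1) • w.2
          + (fderiv ℝ φ z.1 w.1 / φ z.1) • v.2) := by
  refine (hG.warpedForm hφ hpos hK).christoffel_eq hz fun u => ?_
  have hne : φ z.1 ≠ 0 := (hpos _ hz.1).ne'
  simp only [fderiv_warpedForm hG hφ hpos hK hz, warpedForm_apply, map_sub, map_add, map_smul,
    sub_apply, add_apply, smul_apply, smul_eq_mul, hG.apply_christoffel hz.1,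
    hK.apply_christoffel hz.2, hG.apply_grad hz.1]
  field_simp
  ring

lemma fderiv_christoffel_warpedForm (hG : IsMetricOn G U) (hφ : ContDiffOn ℝ ∞ φ U)
    (hpos : ∀ y ∈ U, 0 < φ y) (hK : IsMetricOn K V) (hz : z ∈ U ×ˢ V) (v w d : E × E') :
    fderiv ℝ (fun z => christoffel (warpedForm G φ K) z v w) z d =
      (fderiv ℝ (fun y => christoffel G y v.1 w.1) z.1 d.1
          - (fderiv ℝ φ z.1 d.1 * K z.2 v.2 w.2
            + φ z.1 * fderiv ℝ K z.2 d.2 v.2 w.2) • grad G φ z.1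
          - (φ z.1 * K z.2 v.2 w.2) • fderiv ℝ (grad G φ) z.1 d.1,
        fderiv ℝ (fun y => christoffel K y v.2 w.2) z.2 d.2
          + (fderiv ℝ (fderiv ℝ φ) z.1 d.1 v.1 / φ z.1
            - fderiv ℝ φ z.1 d.1 * fderiv ℝ φ z.1 v.1 / φ z.1 ^ 2) • w.2
          + (fderiv ℝ (fderiv ℝ φ) z.1 d.1 w.1 / φ z.1
            - fderiv ℝ φ z.1 d.1 * fderiv ℝ φ z.1 w.1 / φ z.1 ^ 2) • v.2) := by
  have hne : φ z.1 ≠ 0 := (hpos _ hz.1).ne'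
  have hφC := hφ.contDiffAt (hG.isOpen.mem_nhds hz.1)
  have hφ' := (hφC.differentiableAt (by simp)).hasFDerivAt.comp z hasFDerivAt_fst
  have hdφ := fun a : E => (((hφC.fderiv_right (m := ∞) le_rfl).differentiableAt
    (by simp)).hasFDerivAt.clm_apply (hasFDerivAt_const a z.1)).comp z hasFDerivAt_fst
  have hquot := fun a : E => (hdφ a).mul ((hasDerivAt_inv hne).comp_hasFDerivAt z hφ')
  have hΓ := (hG.differentiableAt_christoffel hz.1 v.1 w.1).hasFDerivAt.comp z hasFDerivAt_fst
  have hΓ' := (hK.differentiableAt_christoffel hz.2 v.2 w.2).hasFDerivAt.comp z hasFDerivAt_snd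
  have hgr := ((hG.contDiffAt_grad hφ hz.1).differentiableAt
    (by simp)).hasFDerivAt.comp z hasFDerivAt_fst
  have hK' := (((hK.differentiableAt hz.2).hasFDerivAt.clm_apply
    (hasFDerivAt_const v.2 z.2)).clm_apply (hasFDerivAt_const w.2 z.2)).comp z hasFDerivAt_snd
  have key := (hΓ.sub ((hφ'.mul hK').smul hgr)).prodMk
    ((hΓ'.add ((hquot v.1).smul (hasFDerivAt_const w.2 z))).add
      ((hquot w.1).smul (hasFDerivAt_const v.2 z)))
  -- The closed formula holds only on `U ×ˢ V`, a neighbourhood of `z`. Quotients become products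
  -- with inverses to match the function differentiated in `key`.
  have hev : (fun z => christoffel (warpedForm G φ K) z v w) =ᶠ[nhds z] _ :=
    Filter.eventuallyEq_of_mem ((hG.isOpen.prod hK.isOpen).mem_nhds hz)
      fun z hz => by
        rw [christoffel_warpedForm hG hφ hpos hK hz, div_eq_mul_inv, div_eq_mul_inv]
  rw [(key.congr_of_eventuallyEq hev).fderiv]
  ext
  · simp only [ContinuousLinearMap.prod_apply, sub_apply, add_apply, smul_apply,
      ContinuousLinearMap.comp_apply, ContinuousLinearMap.coe_fst', ContinuousLinearMap.coe_snd',
      ContinuousLinearMap.smulRight_apply, ContinuousLinearMap.flip_apply, Function.comp_apply,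
      ContinuousLinearMap.comp_zero, zero_add, smul_eq_mul, Pi.mul_apply]
    module
  · simp only [ContinuousLinearMap.prod_apply, add_apply, smul_apply,
      ContinuousLinearMap.comp_apply, ContinuousLinearMap.coe_fst', ContinuousLinearMap.coe_snd',
      ContinuousLinearMap.smulRight_apply, ContinuousLinearMap.flip_apply, Function.comp_apply,
      ContinuousLinearMap.comp_zero, zero_add, smul_eq_mul, smul_zero]
    refine congrArg₂ _ (congrArg₂ _ rfl ?_) ?_ <;> congr 1 <;> field_simp <;> ring

/-- Only the diagonal blocks contribute to the trace of an endomorphism of a product. -/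
lemma trace_prod (L : E × E' →ₗ[ℝ] E × E') :
    LinearMap.trace ℝ (E × E') L =
      LinearMap.trace ℝ E (LinearMap.fst ℝ E E' ∘ₗ L ∘ₗ LinearMap.inl ℝ E E')
      + LinearMap.trace ℝ E' (LinearMap.snd ℝ E E' ∘ₗ L ∘ₗ LinearMap.inr ℝ E E') := by
  have h : L = (L ∘ₗ LinearMap.inl ℝ E E') ∘ₗ LinearMap.fst ℝ E E'
      + (L ∘ₗ LinearMap.inr ℝ E E') ∘ₗ LinearMap.snd ℝ E E' := by
    ext <;> simp [← Prod.zero_eq_mk]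
  conv_lhs => rw [h, map_add]
  exact congrArg₂ _ (LinearMap.trace_comp_comm' _ _) (LinearMap.trace_comp_comm' _ _)

set_option synthInstance.maxHeartbeats 200000 in
-- This lemma and the next three on `riemann` compute the diagonal blocks of `u ↦ R(u, v) w` for
-- `v`, `w` both horizontal or both vertical. By `trace_prod` nothing else enters these Ricci
-- values.
lemma riemann_warpedForm_horizontal_fst (hG : IsMetricOn G U) (hφ : ContDiffOn ℝ ∞ φ U)
    (hpos : ∀ y ∈ U, 0 < φ y) (hK : IsMetricOn K V) (hz : z ∈ U ×ˢ V) (u v w : E) :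
    (riemann (warpedForm G φ K) z (u, 0) (v, 0) (w, 0)).1 = riemann G z.1 u v w := by
  simp only [riemann, fderiv_christoffel_warpedForm hG hφ hpos hK hz,
    christoffel_warpedForm hG hφ hpos hK hz]
  simp

lemma IsMetricOn.christoffel_zero_left (hK : IsMetricOn K V) {y : E'} (hy : y ∈ V) (a : E') :
    christoffel K y 0 a = 0 := by
  simpa using hK.christoffel_smul hy 0 0 a

lemma IsMetricOn.christoffel_zero_right (hK : IsMetricOn K V) {y : E'} (hy : y ∈ V) (a : E') :
    christoffel K y a 0 = 0 := by
  rw [hK.christoffel_symm hy, hK.christoffel_zero_left hy]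

lemma IsMetricOn.fderiv_christoffel_zero_left (hK : IsMetricOn K V) {y : E'} (hy : y ∈ V) (a : E') :
    fderiv ℝ (fun y => christoffel K y 0 a) y = 0 := by
  simpa using hK.fderiv_christoffel_smul hy 0 0 a

lemma IsMetricOn.fderiv_christoffel_zero_right (hK : IsMetricOn K V) {y : E'} (hy : y ∈ V) (a : E') :
    fderiv ℝ (fun y => christoffel K y a 0) y = 0 := by
  rw [← hK.fderiv_christoffel_zero_left hy a]
  exact Filter.EventuallyEq.fderiv_eq (Filter.eventuallyEq_of_mem (hK.isOpen.mem_nhds hy)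
    fun z hz => hK.christoffel_symm hz a 0)

set_option synthInstance.maxHeartbeats 200000 in
lemma riemann_warpedForm_horizontal_snd (hG : IsMetricOn G U) (hφ : ContDiffOn ℝ ∞ φ U)
    (hpos : ∀ y ∈ U, 0 < φ y) (hK : IsMetricOn K V) (hz : z ∈ U ×ˢ V) (p : E') (v w : E) :
    (riemann (warpedForm G φ K) z (0, p) (v, 0) (w, 0)).2
      = -(hess G φ z.1 v w / φ z.1) • p := by
  have hne : φ z.1 ≠ 0 := (hpos _ hz.1).ne'
  simp only [riemann, fderiv_christoffel_warpedForm hG hφ hpos hK hz,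
    christoffel_warpedForm hG hφ hpos hK hz, hess]
  simp [hK.christoffel_zero_left hz.2, hK.christoffel_zero_right hz.2,
    hK.fderiv_christoffel_zero_left hz.2, hK.fderiv_christoffel_zero_right hz.2,
    hG.christoffel_zero_left hz.1]
  match_scalars
  field_simp
  ring

set_option synthInstance.maxHeartbeats 200000 in
lemma riemann_warpedForm_vertical_fst (hG : IsMetricOn G U) (hφ : ContDiffOn ℝ ∞ φ U)
    (hpos : ∀ y ∈ U, 0 < φ y) (hK : IsMetricOn K V) (hz : z ∈ U ×ˢ V) (u : E) (a b : E') :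
    (riemann (warpedForm G φ K) z (u, 0) (0, a) (0, b)).1
      = -(φ z.1 * K z.2 a b) • covGrad G φ z.1 u := by
  have hne : φ z.1 ≠ 0 := (hpos _ hz.1).ne'
  simp only [riemann, fderiv_christoffel_warpedForm hG hφ hpos hK hz,
    christoffel_warpedForm hG hφ hpos hK hz, covGrad]
  simp [hK.christoffel_zero_left hz.2, hK.fderiv_christoffel_zero_left hz.2,
    hG.christoffel_zero_left hz.1, hG.christoffel_zero_right hz.1,
    hG.fderiv_christoffel_zero_left hz.1, hG.fderiv_christoffel_zero_right hz.1]
  rw [← neg_smul _ (grad G φ z.1), ← neg_smul _ (grad G φ z.1), hG.christoffel_smul_right hz.1]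
  match_scalars <;> field_simp
  ring

set_option synthInstance.maxHeartbeats 200000 in
lemma riemann_warpedForm_vertical_snd (hG : IsMetricOn G U) (hφ : ContDiffOn ℝ ∞ φ U)
    (hpos : ∀ y ∈ U, 0 < φ y) (hK : IsMetricOn K V) (hz : z ∈ U ×ˢ V) (p a b : E') :
    (riemann (warpedForm G φ K) z (0, p) (0, a) (0, b)).2
      = riemann K z.2 p a b + (fderiv ℝ φ z.1 (grad G φ z.1)) • (K z.2 p b • a - K z.2 a b • p) := by
  have hne : φ z.1 ≠ 0 := (hpos _ hz.1).ne'
  simp only [riemann, fderiv_christoffel_warpedForm hG hφ hpos hK hz,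
    christoffel_warpedForm hG hφ hpos hK hz]
  simp [hG.christoffel_zero_left hz.1]
  match_scalars <;> field_simp

/-- The base block is the curvature of the base. The fibre block is a multiple of the identity,
whose trace produces the fibre dimension. -/
lemma ricci_warpedForm_horizontal (hG : IsMetricOn G U) (hφ : ContDiffOn ℝ ∞ φ U)
    (hpos : ∀ y ∈ U, 0 < φ y) (hK : IsMetricOn K V) (hz : z ∈ U ×ˢ V) (v w : E) :
    ricci (warpedForm G φ K) z (v, 0) (w, 0) =
      ricci G z.1 v w - Module.finrank ℝ E' * (hess G φ z.1 v w / φ z.1) := by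
  have h1 : LinearMap.fst ℝ E E' ∘ₗ (hG.warpedForm hφ hpos hK).riemannMap hz (w, 0) (v, 0) ∘ₗ
      LinearMap.inl ℝ E E' = hG.riemannMap hz.1 w v :=
    LinearMap.ext fun u => riemann_warpedForm_horizontal_fst hG hφ hpos hK hz u v w
  have h2 : LinearMap.snd ℝ E E' ∘ₗ (hG.warpedForm hφ hpos hK).riemannMap hz (w, 0) (v, 0) ∘ₗ
      LinearMap.inr ℝ E E' = -(hess G φ z.1 v w / φ z.1) • LinearMap.id :=
    LinearMap.ext fun p => riemann_warpedForm_horizontal_snd hG hφ hpos hK hz p v w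
  rw [(hG.warpedForm hφ hpos hK).ricci_eq_trace hz, trace_prod, h1, h2, ← hG.ricci_eq_trace,
    map_smul, LinearMap.trace_id, smul_eq_mul]
  ring

/-- The base block contributes the Laplacian, as the trace of the covariant derivative of the
gradient. In the fibre block `p ↦ K(p, b) a - K(a, b) p` has trace `(1 - dim E') K(a, b)`. -/
lemma ricci_warpedForm_vertical (hG : IsMetricOn G U) (hφ : ContDiffOn ℝ ∞ φ U)
    (hpos : ∀ y ∈ U, 0 < φ y) (hK : IsMetricOn K V) (hz : z ∈ U ×ˢ V) (a b : E') :
    ricci (warpedForm G φ K) z (0, a) (0, b) =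
      ricci K z.2 a b - (φ z.1 * LinearMap.trace ℝ E (hG.covGradMap hz.1 φ)
        + (Module.finrank ℝ E' - 1) * fderiv ℝ φ z.1 (grad G φ z.1)) * K z.2 a b := by
  have h1 : LinearMap.fst ℝ E E' ∘ₗ (hG.warpedForm hφ hpos hK).riemannMap hz (0, b) (0, a) ∘ₗ
      LinearMap.inl ℝ E E' = -(φ z.1 * K z.2 a b) • hG.covGradMap hz.1 φ :=
    LinearMap.ext fun u => riemann_warpedForm_vertical_fst hG hφ hpos hK hz u a b
  have h2 : LinearMap.snd ℝ E E' ∘ₗ (hG.warpedForm hφ hpos hK).riemannMap hz (0, b) (0, a) ∘ₗ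
      LinearMap.inr ℝ E E' = hK.riemannMap hz.2 b a + fderiv ℝ φ z.1 (grad G φ z.1) •
        ((K z.2 b : E' →ₗ[ℝ] ℝ).smulRight a - K z.2 a b • LinearMap.id) :=
    LinearMap.ext fun p => (riemann_warpedForm_vertical_snd hG hφ hpos hK hz p a b).trans
      (by rw [hK.symm z.2 hz.2 p b]; rfl)
  rw [(hG.warpedForm hφ hpos hK).ricci_eq_trace hz, trace_prod, h1, h2, map_add, map_smul,
    map_smul, map_sub, map_smul, LinearMap.trace_id, ← hK.ricci_eq_trace,
    LinearMap.trace_smulRight, ContinuousLinearMap.coe_coe, hK.symm z.2 hz.2 b a]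
  simp only [smul_eq_mul]
  ring

end LocalWarped

/-! ### Two-dimensional curvature identities and the local form of the theorem. -/

section LocalSurface

variable {E : Type*} [NormedAddCommGroup E] [NormedSpace ℝ E] [FiniteDimensional ℝ E]
  {E' : Type*} [NormedAddCommGroup E'] [NormedSpace ℝ E'] [FiniteDimensional ℝ E']

/-- On a plane, an alternating bilinear map with values in the plane is determined by its
contraction. -/
lemma alternating_apply_eq_trace (hE : Module.finrank ℝ E = 2) (A : E →ₗ[ℝ] E →ₗ[ℝ] E)
    (hA : ∀ u v, A u v = -A v u) (u v : E) :
    A v u = LinearMap.trace ℝ E (A v) • u - LinearMap.trace ℝ E (A u) • v := by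
  let b := Module.finBasisOfFinrankEq ℝ E hE
  have hself : ∀ x, A x x = 0 := fun x => by
    simpa [← two_smul ℝ] using add_eq_zero_iff_eq_neg.2 (hA x x)
  have htr : ∀ x, LinearMap.trace ℝ E (A x) =
      b.repr (A x (b 0)) 0 + b.repr (A x (b 1)) 1 := fun x => by
    rw [LinearMap.trace_eq_matrix_trace ℝ b, Matrix.trace, Fin.sum_univ_two]
    simp [LinearMap.toMatrix_apply]
  have hsum : ∀ x, x = b.repr x 0 • b 0 + b.repr x 1 • b 1 := fun x => by
    conv_lhs => rw [← b.sum_repr x, Fin.sum_univ_two]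
  have hb : A (b 0) (b 1) = -A (b 1) (b 0) := hA _ _
  have h0 : ∀ x, A x (b 0) = b.repr x 1 • A (b 1) (b 0) := fun x => by
    conv_lhs => rw [hsum x]
    simp [hself]
  have h1 : ∀ x, A x (b 1) = -(b.repr x 0 • A (b 1) (b 0)) := fun x => by
    conv_lhs => rw [hsum x]
    simp [hself, hb]
  -- Alternating forms on a plane form a line: every value of `A` is a determinant times `A (b 1) (b
  -- 0)`.
  have hAvu : A v u =
      (b.repr v 1 * b.repr u 0 - b.repr v 0 * b.repr u 1) • A (b 1) (b 0) := by
    conv_lhs => rw [hsum u]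
    rw [map_add, map_smul, map_smul, h0, h1]
    module
  apply b.ext_elem
  rw [hAvu, htr, htr, h0 u, h0 v, h1 u, h1 v]
  intro i
  fin_cases i <;> simp <;> ring

variable {G : E → E →L[ℝ] E →L[ℝ] ℝ} {φ : E → ℝ} {K : E' → E' →L[ℝ] E' →L[ℝ] ℝ}
  {U : Set E} {V : Set E'} {y : E}

/-- On a surface the Ricci curvature determines the Riemann curvature. -/
lemma IsMetricOn.riemann_eq_ricci (hG : IsMetricOn G U) (hE : Module.finrank ℝ E = 2)
    (hy : y ∈ U) (u v w : E) :
    riemann G y u v w = ricci G y v w • u - ricci G y u w • v := by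
  rw [hG.ricci_eq_trace hy, hG.ricci_eq_trace hy]
  exact alternating_apply_eq_trace hE (hG.riemannMap hy w)
    (fun u v => riemann_antisymm G y v u w) u v

/-- On a surface the Ricci form is pointwise proportional to the metric. -/
lemma IsMetricOn.apply_eq_trace_mul (hG : IsMetricOn G U) (hE : Module.finrank ℝ E = 2)
    (hy : y ∈ U) (S : E →ₗ[ℝ] E) (hS : ∀ v w, ricci G y v w = G y (S v) w) (v w : E) :
    2 * G y (S v) w = LinearMap.trace ℝ E S * G y v w := by
  -- Insert `R(u, v) w = Ric(v, w) u - Ric(u, w) v` into `G(R(u, v) w, w) = 0`.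
  have hskew : ∀ u v w, G y (S v) w * G y u w = G y (S u) w * G y v w := fun u v w => by
    have := hG.apply_riemann_self hy u v w
    rw [hG.riemann_eq_ricci hE hy, hS, hS] at this
    simp only [map_sub, map_smul, sub_apply, smul_apply, smul_eq_mul] at this
    linarith
  -- Polarization of `hskew` in `w`, with the second argument `x` stripped off by nondegeneracy.
  -- Both sides are now endomorphisms applied to `u`, and tracing them gives the claim: the rank-one
  -- terms cancel and the identity has trace 2.
  have hpol : ∀ u, G y (S v) w • u + G y w u • S v = G y w (S u) • v + G y v w • S u :=
    fun u => hG.ext hy fun x => by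
      have h1 := hskew u v (w + x)
      have h2 := hskew u v w
      have h3 := hskew u v x
      simp only [map_add, map_smul, add_apply, smul_apply, smul_eq_mul] at h1 ⊢
      rw [hG.symm y hy w u, hG.symm y hy w (S u)]
      linarith
  have hmap : G y (S v) w • LinearMap.id + (G y w : E →ₗ[ℝ] ℝ).smulRight (S v) =
      ((G y w : E →ₗ[ℝ] ℝ) ∘ₗ S).smulRight v + G y v w • S := LinearMap.ext hpol
  have := congrArg (LinearMap.trace ℝ E) hmap
  simp only [map_add, map_smul, LinearMap.trace_id, LinearMap.trace_smulRight, hE, smul_eq_mul,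
    LinearMap.comp_apply, ContinuousLinearMap.coe_coe] at this
  rw [hG.symm y hy w (S v)] at this
  push_cast at this
  linarith

/-- A Ricci-flat warped product of surfaces with Ricci-flat fiber whose base has scalar curvature
proportional to the warping function has constant warping function. -/
lemma fderiv_eq_zero_of_ricci_warpedForm (hG : IsMetricOn G U) (hE : Module.finrank ℝ E = 2)
    (hφ : ContDiffOn ℝ ∞ φ U) (hpos : ∀ y ∈ U, 0 < φ y) (hK : IsMetricOn K V)
    (hE' : Module.finrank ℝ E' = 2) (hV : V.Nonempty) (hKflat : ∀ y ∈ V, ∀ a b, ricci K y a b = 0)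
    (hW : ∀ z ∈ U ×ˢ V, ∀ v w, ricci (warpedForm G φ K) z v w = 0) {c : ℝ}
    (hc : ∀ y ∈ U, scalar G y = c * φ y) (hy : y ∈ U) : fderiv ℝ φ y = 0 := by
  obtain ⟨x, hx⟩ := hV
  -- Horizontal equation: `Ric = (2/φ) Hess φ`.
  have hric : ∀ {y} (hy : y ∈ U) v w,
      ricci G y v w = G y (((2 / φ y) • hG.covGradMap hy φ) v) w := fun {y} hy v w => by
    have h1 := ricci_warpedForm_horizontal (z := (y, x)) hG hφ hpos hK ⟨hy, hx⟩ v w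
    rw [hW _ ⟨hy, hx⟩, hE'] at h1
    simp only [LinearMap.smul_apply, hG.covGradMap_apply, map_smul, smul_apply,
      hG.apply_covGrad hφ hy, smul_eq_mul]
    push_cast at h1
    linear_combination -h1
  have htr : ∀ {y} (hy : y ∈ U),
      LinearMap.trace ℝ E (hG.covGradMap hy φ) = c * φ y ^ 2 / 2 := fun {y} hy => by
    have hne := (hpos y hy).ne'
    have h1 := hG.scalar_eq_trace hy _ (hric hy) fun v w => by
      simp only [LinearMap.smul_apply, hG.covGradMap_apply, map_smul, smul_apply,
        hG.apply_covGrad hφ hy, hG.hess_symm hφ hy v w]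
    rw [hc y hy, map_smul, smul_eq_mul] at h1
    field_simp at h1
    linarith
  -- Vertical equation at a nonzero fibre vector `a`, where the factor `K(a, a)` cancels.
  have hnorm : ∀ y ∈ U, G y (grad G φ y) (grad G φ y) = -(c / 2) * φ y ^ 3 := fun y hy => by
    have : Nontrivial E' := Module.nontrivial_of_finrank_pos (R := ℝ) (by omega)
    obtain ⟨a, ha⟩ := exists_ne (0 : E')
    have h1 := ricci_warpedForm_vertical (z := (y, x)) hG hφ hpos hK ⟨hy, hx⟩ a a
    rw [hW _ ⟨hy, hx⟩, hKflat x hx, hE', htr hy] at h1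
    have h2 := (hK.pos x hx a ha).ne'
    have h3 := (mul_eq_zero.1 (neg_eq_zero.1 ((zero_sub _).symm.trans h1.symm))).resolve_right h2
    push_cast at h3
    rw [hG.apply_grad hy]
    linear_combination h3
  have hhess : ∀ u w, G y (covGrad G φ y u) w = c * φ y ^ 2 / 4 * G y u w := fun u w => by
    have hne := (hpos y hy).ne'
    have h1 := hG.apply_eq_trace_mul hE hy _ (hric hy) u w
    simp only [LinearMap.smul_apply, map_smul, hG.covGradMap_apply, smul_apply, smul_eq_mul,
      htr hy] at h1
    field_simp at h1 ⊢
    linarith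
  -- The derivative of `hnorm` along `u` has left side `2 Hess φ(u, grad φ)`; `hhess` evaluates the
  -- same quantity, with a different coefficient.
  have hderiv : ∀ u, c * φ y ^ 2 * fderiv ℝ φ y u = 0 := fun u => by
    have hgr := ((hG.contDiffAt_grad hφ hy).differentiableAt (by simp)).hasFDerivAt
    have hl := ((hG.differentiableAt hy).hasFDerivAt.clm_apply hgr).clm_apply hgr
    have hφ' := ((hφ.contDiffAt (hG.isOpen.mem_nhds hy)).differentiableAt (by simp)).hasFDerivAt
    have hr := (hφ'.pow 3).const_mul (-(c / 2))
    have h1 := congrArg (fun L => L u) (hl.unique (hr.congr_of_eventuallyEq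
      (Filter.eventuallyEq_of_mem (hG.isOpen.mem_nhds hy) hnorm)))
    have h2 := hhess u (grad G φ y)
    simp only [covGrad, map_add, add_apply] at h2
    simp only [ContinuousLinearMap.flip_apply, add_apply, ContinuousLinearMap.comp_apply,
      smul_apply, smul_eq_mul, nsmul_eq_mul, hG.fderiv_eq_christoffel hy] at h1
    rw [hG.symm y hy (grad G φ y) (fderiv ℝ (grad G φ) y u),
      hG.symm y hy (grad G φ y) (christoffel G y u (grad G φ y))] at h1
    rw [hG.symm y hy u, hG.apply_grad hy] at h2
    push_cast at h1
    linear_combination (1 / 2 : ℝ) * h1 - h2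
  by_cases hc0 : c = 0
  · have h0 : grad G φ y = 0 := by
      by_contra hne
      have := hG.pos y hy _ hne
      rw [hnorm y hy, hc0] at this
      simp at this
    rw [← hG.apply_grad hy, h0, map_zero]
  · ext u
    have hne := (hpos y hy).ne'
    exact (mul_eq_zero.1 (hderiv u)).resolve_left (by positivity)

/-- If the warping function is locally constant, the base of a Ricci-flat warped product of
surfaces is flat. -/
lemma riemann_eq_zero_of_ricci_warpedForm (hG : IsMetricOn G U) (hE : Module.finrank ℝ E = 2)
    (hφ : ContDiffOn ℝ ∞ φ U) (hpos : ∀ y ∈ U, 0 < φ y) (hK : IsMetricOn K V)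
    (hV : V.Nonempty) (hW : ∀ z ∈ U ×ˢ V, ∀ v w, ricci (warpedForm G φ K) z v w = 0)
    (hconst : ∀ y ∈ U, fderiv ℝ φ y = 0) (hy : y ∈ U) (u v w : E) :
    riemann G y u v w = 0 := by
  obtain ⟨x, hx⟩ := hV
  have hdd : fderiv ℝ (fderiv ℝ φ) y = 0 := by
    rw [(Filter.eventuallyEq_of_mem (hG.isOpen.mem_nhds hy) hconst :
      fderiv ℝ φ =ᶠ[nhds y] fun _ => 0).fderiv_eq]
    simp
  have hric : ∀ v w, ricci G y v w = 0 := fun v w => by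
    have h1 := ricci_warpedForm_horizontal (z := (y, x)) hG hφ hpos hK ⟨hy, hx⟩ v w
    rw [hW _ ⟨hy, hx⟩, hess, hdd, hconst y hy] at h1
    simpa using h1.symm
  rw [hG.riemann_eq_ricci hE hy, hric, hric, zero_smul, zero_smul, sub_zero]

end LocalSurface

/-! ### Riemannian metrics and warped products read in charts. -/

section Charts

variable {E : Type*} [NormedAddCommGroup E] [NormedSpace ℝ E]
  {H : Type*} [TopologicalSpace H] {I : ModelWithCorners ℝ E H}
  {B : Type*} [TopologicalSpace B] [ChartedSpace H B]
  {E' : Type*} [NormedAddCommGroup E'] [NormedSpace ℝ E']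
  {H' : Type*} [TopologicalSpace H'] {J : ModelWithCorners ℝ E' H'}
  {F : Type*} [TopologicalSpace F] [ChartedSpace H' F]

lemma contMDiffOn_extend_symm_target [IsManifold I ∞ B] {e : OpenPartialHomeomorph B H}
    (he : e ∈ atlas H B) :
    ContMDiffOn 𝓘(ℝ, E) I ∞ (e.extend I).symm (e.extend I).target := by
  have := contMDiffOn_extend_symm (I := I) (n := ∞)
    (IsManifold.subset_maximalAtlas (I := I) (n := ∞) he)
  rwa [← e.extend_target'] at this

lemma mdifferentiableAt_extend_symm [IsManifold I ∞ B] [I.Boundaryless]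
    {e : OpenPartialHomeomorph B H} (he : e ∈ atlas H B) {y : E} (hy : y ∈ (e.extend I).target) :
    MDifferentiableAt 𝓘(ℝ, E) I (e.extend I).symm y :=
  ((contMDiffOn_extend_symm_target he).contMDiffAt
    (e.isOpen_extend_target.mem_nhds hy)).mdifferentiableAt (by simp)

/-- By the chain rule the derivative of the chart is a left inverse. Injectivity makes the
pulled-back metric definite. -/
lemma mfderiv_extend_symm_injective [IsManifold I ∞ B] [I.Boundaryless]
    {e : OpenPartialHomeomorph B H} (he : e ∈ atlas H B) {y : E} (hy : y ∈ (e.extend I).target) :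
    Function.Injective (mfderiv 𝓘(ℝ, E) I (e.extend I).symm y) := by
  have h1 := mdifferentiableAt_extend_symm he hy
  have hx : (e.extend I).symm y ∈ e.source := by
    rw [← e.extend_source (I := I)]
    exact (e.extend I).map_target hy
  have h2 : MDifferentiableAt I 𝓘(ℝ, E) (e.extend I) ((e.extend I).symm y) :=
    ((e.contMDiffOn_extend (I := I) (n := ∞)
      (IsManifold.subset_maximalAtlas (I := I) (n := ∞) he)).contMDiffAt
      (e.open_source.mem_nhds hx)).mdifferentiableAt (by simp)
  have h3 := mfderiv_comp y h2 h1
  have h4 : (e.extend I) ∘ (e.extend I).symm =ᶠ[nhds y] id :=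
    Filter.eventuallyEq_of_mem (e.isOpen_extend_target.mem_nhds hy)
      fun z hz => (e.extend I).right_inv hz
  rw [h4.mfderiv_eq, mfderiv_id] at h3
  exact Function.LeftInverse.injective (g := mfderiv I 𝓘(ℝ, E) (e.extend I) ((e.extend I).symm y))
    fun v => (congrArg (fun L => L v) h3).symm

/-- The coordinate vector fields of a chart are smooth. -/
lemma contMDiffOn_mfderiv_extend_symm [IsManifold I ∞ B] [I.Boundaryless]
    {e : OpenPartialHomeomorph B H} (he : e ∈ atlas H B) (v : E) :
    ContMDiffOn 𝓘(ℝ, E) I.tangent ∞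
      (fun y => (⟨(e.extend I).symm y, mfderiv 𝓘(ℝ, E) I (e.extend I).symm y v⟩ :
        TangentBundle I B)) (e.extend I).target := by
  have ho := e.isOpen_extend_target (I := I)
  have : IsManifold I 1 B := IsManifold.of_le (n := ∞) (by simp)
  -- The coordinate field is the tangent map of the inverse chart composed with the constant section
  -- `v`.
  have h := (contMDiffOn_extend_symm_target (I := I) he).contMDiffOn_tangentMapWithin
    (m := ∞) le_rfl ho.uniqueMDiffOn
  have hsec : ContMDiff 𝓘(ℝ, E) 𝓘(ℝ, E).tangent ∞
      (fun y : E => (⟨y, v⟩ : TangentBundle 𝓘(ℝ, E) E)) := by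
    exact contMDiff_vectorSpace_iff_contDiff.2 contDiff_const
  refine (h.comp hsec.contMDiffOn fun y hy => hy).congr fun y hy => ?_
  simp only [Function.comp_apply, tangentMapWithin, mfderivWithin_of_isOpen ho hy]

/-- The scalar product of two smooth families of vectors is smooth. -/
lemma contMDiffOn_inner {EB : Type*} [NormedAddCommGroup EB] [NormedSpace ℝ EB]
    {HB : Type*} [TopologicalSpace HB] {IB : ModelWithCorners ℝ EB HB}
    {B : Type*} [TopologicalSpace B] [ChartedSpace HB B]
    {F : Type*} [NormedAddCommGroup F] [NormedSpace ℝ F]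
    {Z : B → Type*} [TopologicalSpace (Bundle.TotalSpace F Z)] [∀ x, TopologicalSpace (Z x)]
    [∀ x, AddCommGroup (Z x)] [∀ x, Module ℝ (Z x)] [∀ x, IsTopologicalAddGroup (Z x)]
    [∀ x, ContinuousSMul ℝ (Z x)] [FiberBundle F Z] [VectorBundle ℝ F Z]
    {EM : Type*} [NormedAddCommGroup EM] [NormedSpace ℝ EM]
    {HM : Type*} [TopologicalSpace HM] {IM : ModelWithCorners ℝ EM HM}
    {M : Type*} [TopologicalSpace M] [ChartedSpace HM M]
    {n : ℕ∞ω} (g : Bundle.ContMDiffRiemannianMetric IB n F Z)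
    {b : M → B} {v w : ∀ x, Z (b x)} {s : Set M} (hb : ContMDiffOn IM IB n b s)
    (hv : ContMDiffOn IM (IB.prod 𝓘(ℝ, F)) n (fun m => Bundle.TotalSpace.mk' F (b m) (v m)) s)
    (hw : ContMDiffOn IM (IB.prod 𝓘(ℝ, F)) n (fun m => Bundle.TotalSpace.mk' F (b m) (w m)) s) :
    ContMDiffOn IM 𝓘(ℝ, ℝ) n (fun m => g.inner (b m) (v m) (w m)) s := by
  have h : ContMDiffOn IM (IB.prod 𝓘(ℝ)) n (fun m => Bundle.TotalSpace.mk' ℝ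
      (E := Bundle.Trivial B ℝ) (b m) (g.inner (b m) (v m) (w m))) s := by
    apply ContMDiffOn.clm_bundle_apply₂ (F₁ := F) (F₂ := F)
    · exact g.contMDiff.comp_contMDiffOn hb
    · exact hv
    · exact hw
  intro x hx
  have hx := h x hx
  simp only [Bundle.contMDiffWithinAt_totalSpace] at hx
  exact hx.2

lemma inChart_apply (g : FormField I B) (e : OpenPartialHomeomorph B H) (y v w : E) :
    inChart g e y v w = g ((e.extend I).symm y) (mfderiv 𝓘(ℝ, E) I (e.extend I).symm y v)
      (mfderiv 𝓘(ℝ, E) I (e.extend I).symm y w) := rfl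

lemma contDiffOn_inChart_apply [IsManifold I ∞ B] [I.Boundaryless]
    (g : Bundle.ContMDiffRiemannianMetric I ∞ E (fun x : B => TangentSpace I x))
    {e : OpenPartialHomeomorph B H} (he : e ∈ atlas H B) (v w : E) :
    ContDiffOn ℝ ∞ (fun y => inChart g.inner e y v w) (e.extend I).target := by
  have h := contMDiffOn_inner (IM := 𝓘(ℝ, E)) (b := (e.extend I).symm)
    (v := fun y => mfderiv 𝓘(ℝ, E) I (e.extend I).symm y v)
    (w := fun y => mfderiv 𝓘(ℝ, E) I (e.extend I).symm y w)
    g (contMDiffOn_extend_symm_target he) (contMDiffOn_mfderiv_extend_symm he v)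
    (contMDiffOn_mfderiv_extend_symm he w)
  exact contMDiffOn_iff_contDiffOn.1 h

lemma inChart_pos [IsManifold I ∞ B] [I.Boundaryless]
    (g : Bundle.ContMDiffRiemannianMetric I ∞ E (fun x : B => TangentSpace I x))
    {e : OpenPartialHomeomorph B H} (he : e ∈ atlas H B) {y : E} (hy : y ∈ (e.extend I).target)
    {v : E} (hv : v ≠ 0) : 0 < inChart g.inner e y v v := by
  rw [inChart_apply]
  refine g.pos _ _ fun h => hv (mfderiv_extend_symm_injective he hy ?_)
  exact h.trans (map_zero _).symm

lemma inChart_symm [IsManifold I ∞ B]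
    (g : Bundle.ContMDiffRiemannianMetric I ∞ E (fun x : B => TangentSpace I x))
    (e : OpenPartialHomeomorph B H) (y v w : E) :
    inChart g.inner e y v w = inChart g.inner e y w v := by
  rw [inChart_apply, inChart_apply, g.symm]

/-- In a chart, a smooth Riemannian metric is a smooth family of scalar products. -/
lemma isMetricOn_inChart [FiniteDimensional ℝ E] [IsManifold I ∞ B] [I.Boundaryless]
    (g : Bundle.ContMDiffRiemannianMetric I ∞ E (fun x : B => TangentSpace I x))
    {e : OpenPartialHomeomorph B H} (he : e ∈ atlas H B) :
    IsMetricOn (inChart g.inner e) (e.extend I).target where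
  isOpen := e.isOpen_extend_target
  contDiffOn := contDiffOn_clm_apply.2 fun v => contDiffOn_clm_apply.2 fun w =>
    contDiffOn_inChart_apply g he v w
  symm y _ v w := inChart_symm g e y v w
  pos _ hy _ hv := inChart_pos g he hy hv

lemma inChart_warped [IsManifold I ∞ B] [I.Boundaryless] [IsManifold J ∞ F] [J.Boundaryless]
    (g : FormField I B) (f : B → ℝ) (k : FormField J F)
    {e : OpenPartialHomeomorph B H} (he : e ∈ atlas H B)
    {e' : OpenPartialHomeomorph F H'} (he' : e' ∈ atlas H' F) {z : E × E'}
    (hz : z ∈ (e.extend I).target ×ˢ (e'.extend J).target) :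
    inChart (warped g f k) (e.prod e') z =
      warpedForm (inChart g e) (fun y => f ((e.extend I).symm y)) (inChart k e') z := by
  have hmem : (e.prod e') ∈ atlas (ModelProd H H') (B × F) := ⟨e, he, e', he', rfl⟩
  have hz' : z ∈ ((e.prod e').extend (I.prod J)).target := by
    rw [OpenPartialHomeomorph.extend_prod]; exact hz
  have hd := mdifferentiableAt_extend_symm (I := I.prod J) hmem hz'
  have h1 : ∀ v, mfderiv (I.prod J) I Prod.fst (((e.prod e').extend (I.prod J)).symm z)
      (mfderiv 𝓘(ℝ, E × E') (I.prod J) ((e.prod e').extend (I.prod J)).symm z v) =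
      mfderiv 𝓘(ℝ, E) I (e.extend I).symm z.1 v.1 := fun v => by
    -- The manifold projection after the inverse product chart is the same function as the inverse
    -- chart after the linear projection; the chain rule is applied to both composites.
    have hl := mfderiv_comp z (mdifferentiableAt_fst (I := I) (I' := J)) hd
    have hr := mfderiv_comp (I := 𝓘(ℝ, E × E')) z (mdifferentiableAt_extend_symm (I := I) he hz.1)
      (differentiableAt_fst (𝕜 := ℝ)).mdifferentiableAt
    rw [mfderiv_eq_fderiv, fderiv_fst] at hr
    exact congrArg (fun L => L v) (hl.symm.trans hr)
  have h2 : ∀ v, mfderiv (I.prod J) J Prod.snd (((e.prod e').extend (I.prod J)).symm z)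
      (mfderiv 𝓘(ℝ, E × E') (I.prod J) ((e.prod e').extend (I.prod J)).symm z v) =
      mfderiv 𝓘(ℝ, E') J (e'.extend J).symm z.2 v.2 := fun v => by
    have hl := mfderiv_comp z (mdifferentiableAt_snd (I := I) (I' := J)) hd
    have hr := mfderiv_comp (I := 𝓘(ℝ, E × E')) z (mdifferentiableAt_extend_symm (I := J) he' hz.2)
      (differentiableAt_snd (𝕜 := ℝ)).mdifferentiableAt
    rw [mfderiv_eq_fderiv, fderiv_snd] at hr
    exact congrArg (fun L => L v) (hl.symm.trans hr)
  refine ContinuousLinearMap.ext fun v => ContinuousLinearMap.ext fun w => ?_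
  rw [warpedForm_apply, inChart_apply, inChart_apply, inChart_apply, ← h1 v, ← h1 w, ← h2 v,
    ← h2 w]
  rfl

end Charts

end WarpedSurface

end

/-! ### From charts to the whole surface. -/

theorem theorem1
    {B : Type*} [TopologicalSpace B] [ChartedSpace (EuclideanSpace ℝ (Fin 2)) B]
    [IsManifold (𝓡 2) ∞ B] [ConnectedSpace B]
    {F : Type*} [TopologicalSpace F] [ChartedSpace (EuclideanSpace ℝ (Fin 2)) F]
    [IsManifold (𝓡 2) ∞ F] [Nonempty F]
    (g : Bundle.ContMDiffRiemannianMetric (𝓡 2) ∞ (EuclideanSpace ℝ (Fin 2))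
      (fun x : B => TangentSpace (𝓡 2) x))
    (k : Bundle.ContMDiffRiemannianMetric (𝓡 2) ∞ (EuclideanSpace ℝ (Fin 2))
      (fun x : F => TangentSpace (𝓡 2) x))
    (f : B → ℝ) (hf : ContMDiff (𝓡 2) 𝓘(ℝ, ℝ) ∞ f) (hf_pos : ∀ x, 0 < f x)
    (c : ℝ) (hR : WarpedSurface.HasScalarCurvature g.inner (fun x => c * f x))
    (hF : WarpedSurface.IsRicciFlat k.inner)
    (hM : WarpedSurface.IsRicciFlat (WarpedSurface.warped g.inner f k.inner)) :
    (∃ a : ℝ, ∀ x, f x = a) ∧ WarpedSurface.IsFlat g.inner := by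
  have hrank : Module.finrank ℝ (EuclideanSpace ℝ (Fin 2)) = 2 := by simp
  obtain ⟨p⟩ := ‹Nonempty F›
  -- One chart of the fibre suffices: the equations on the base need only one point of the fibre.
  let e' := chartAt (EuclideanSpace ℝ (Fin 2)) p
  have he' : e' ∈ atlas (EuclideanSpace ℝ (Fin 2)) F := chart_mem_atlas _ p
  have hV : (e'.extend (𝓡 2)).target.Nonempty :=
    ⟨_, (e'.extend (𝓡 2)).map_source (by rw [e'.extend_source]; exact mem_chart_source _ p)⟩
  have hK := WarpedSurface.isMetricOn_inChart k he'
  have hφ : ∀ e ∈ atlas (EuclideanSpace ℝ (Fin 2)) B, ContDiffOn ℝ ∞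
      (fun y => f ((e.extend (𝓡 2)).symm y)) (e.extend (𝓡 2)).target := fun e he =>
    contMDiffOn_iff_contDiffOn.1
      (hf.comp_contMDiffOn (WarpedSurface.contMDiffOn_extend_symm_target he))
  have hW : ∀ e ∈ atlas (EuclideanSpace ℝ (Fin 2)) B,
      ∀ z ∈ (e.extend (𝓡 2)).target ×ˢ (e'.extend (𝓡 2)).target, ∀ v w,
      WarpedSurface.ricci (WarpedSurface.warpedForm (WarpedSurface.inChart g.inner e)
        (fun y => f ((e.extend (𝓡 2)).symm y)) (WarpedSurface.inChart k.inner e')) z v w = 0 := by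
    intro e he z hz v w
    rw [← hM (e.prod e') ⟨e, he, e', he', rfl⟩ z
      (by rw [OpenPartialHomeomorph.extend_prod]; exact hz) v w]
    exact (WarpedSurface.ricci_congr (e.isOpen_extend_target.prod e'.isOpen_extend_target)
      (fun z hz => WarpedSurface.inChart_warped g.inner f k.inner he he' hz) hz v w).symm
  have hzero : ∀ e ∈ atlas (EuclideanSpace ℝ (Fin 2)) B, ∀ y ∈ (e.extend (𝓡 2)).target,
      fderiv ℝ (fun y => f ((e.extend (𝓡 2)).symm y)) y = 0 := fun e he y hy =>
    WarpedSurface.fderiv_eq_zero_of_ricci_warpedForm (WarpedSurface.isMetricOn_inChart g he) hrank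
      (hφ e he) (fun _ _ => hf_pos _) hK hrank hV (hF e' he') (hW e he) (hR e he) hy
  refine ⟨?_, fun e he y hy u v w =>
    WarpedSurface.riemann_eq_zero_of_ricci_warpedForm (WarpedSurface.isMetricOn_inChart g he) hrank
      (hφ e he) (fun _ _ => hf_pos _) hK hV (hW e he) (hzero e he) hy u v w⟩
  have hloc : IsLocallyConstant f := by
    rw [IsLocallyConstant.iff_eventually_eq]
    intro x
    let e := chartAt (EuclideanSpace ℝ (Fin 2)) x
    have he : e ∈ atlas (EuclideanSpace ℝ (Fin 2)) B := chart_mem_atlas _ x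
    have hx : x ∈ e.source := mem_chart_source _ x
    have hxt : e.extend (𝓡 2) x ∈ (e.extend (𝓡 2)).target :=
      (e.extend (𝓡 2)).map_source (by rw [e.extend_source]; exact hx)
    obtain ⟨r, hr, hball⟩ := Metric.isOpen_iff.1 e.isOpen_extend_target _ hxt
    -- The chart target need not be connected, so the vanishing derivative is integrated on a ball
    -- inside it.
    have hconst : ∀ y ∈ Metric.ball (e.extend (𝓡 2) x) r,
        f ((e.extend (𝓡 2)).symm y) = f ((e.extend (𝓡 2)).symm (e.extend (𝓡 2) x)) :=
      fun y hy => Metric.isOpen_ball.is_const_of_fderiv_eq_zero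
        (f := fun y => f ((e.extend (𝓡 2)).symm y)) (𝕜 := ℝ)
        (convex_ball _ _).isPreconnected
        (((hφ e he).mono hball).differentiableOn (by simp))
        (fun z hz => hzero e he z (hball hz)) hy (Metric.mem_ball_self hr)
    have hnear : ∀ᶠ x' in nhds x, e.extend (𝓡 2) x' ∈ Metric.ball (e.extend (𝓡 2) x) r :=
      (e.continuousAt_extend hx).eventually (Metric.ball_mem_nhds _ hr)
    filter_upwards [hnear, e.open_source.mem_nhds hx] with x' h1 h2
    have := hconst _ h1
    rwa [e.extend_left_inv h2, e.extend_left_inv hx] at this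
  exact ⟨f (Classical.arbitrary B), fun x => hloc.apply_eq_of_preconnectedSpace x _⟩
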